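/- Let $\mathcal{A}$ be a nonempty finite set and let $F$ be a set of maps from $\mathcal{A}$ to $\mathcal{A}$. A shift space over a finite alphabet $B$ is a set $X\subseteq B^{\mathbb{Z}}$ for which there is a (possibly infinite) collection of finite blocks over $B$ such that $X$ consists exactly of the bi-infinite sequences in which no block of the collection occurs. The language $\mathcal{B}(X)$ is the set of all finite blocks (including the empty one) that occur in points of $X$. A functional shift is a shift space $\mathcal{F}\subseteq F^{\mathbb{Z}}$ over the alphabet $F$, and the shift generated by $\mathcal{F}$ is $$X_{\mathcal{F}}=\{(x_i)_{i\in\mathbb{Z}}\in\mathcal{A}^{\mathbb{Z}} \mid \exists (f_i)_{i\in\mathbb{Z}}\in\mathcal{F}\ \forall i\in\mathbb{Z}:\ x_{i+1}=f_i(x_i)\}.$$ Theorem. If $\mathcal{F}$ is a functional shift and $\mathcal{B}(\mathcal{F})$ is a context-free language (over $F$), then $\mathcal{B}(X_{\mathcal{F}})$ is a context-free language (over $\mathcal{A}$). Here a language is context free if it is generated by a context-free grammar; productions with an empty right-hand side are allowed. -/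

import Mathlib

namespace SymDyn

/-- The `n`-block `x i, x (i+1), …, x (i+n-1)` of a bi-infinite sequence `x`. -/
def block {A : Type*} (x : ℤ → A) (i : ℤ) (n : ℕ) : List A :=
  List.ofFn (fun k : Fin n => x (i + (k : ℕ)))

/-- The block `w` occurs somewhere in the bi-infinite sequence `x`. -/
def Occurs {A : Type*} (w : List A) (x : ℤ → A) : Prop :=
  ∃ i : ℤ, block x i w.length = w

/-- The set of bi-infinite sequences in which no block of `forb` occurs. -/
def avoiding {A : Type*} (forb : Set (List A)) : Set (ℤ → A) :=
  {x | ∀ w ∈ forb, ¬ Occurs w x}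

/-- A shift space over `A`: a set of bi-infinite sequences that is described by some (arbitrary,
possibly infinite) collection of forbidden blocks. -/
def IsShiftSpace {A : Type*} (X : Set (ℤ → A)) : Prop :=
  ∃ forb : Set (List A), X = avoiding forb

/-- `𝓑(X)`: all blocks, of every length `n ≥ 0`, that occur in points of `X`. -/
def blockLanguage {A : Type*} (X : Set (ℤ → A)) : Language A :=
  {w : List A | ∃ x ∈ X, Occurs w x}

/-- The shift generated by a set `𝓕` of bi-infinite sequences of maps from a set `F` of self-maps
of `A`: all `x` such that `x (i+1) = f i (x i)` for every `i`, for some `f ∈ 𝓕`. -/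
def generatedShift {A : Type*} {F : Set (A → A)} (𝓕 : Set (ℤ → F)) : Set (ℤ → A) :=
  {x | ∃ f ∈ 𝓕, ∀ i : ℤ, x (i + 1) = (f i : A → A) (x i)}

end SymDyn

/-!
A word `w` occurs in a point of the generated shift exactly when it is the word of states visited
while a block of the functional shift is read, and the first state can be reached at the end of
arbitrarily long blocks preceding that one: the infinite past that is required is then obtained by
compactness (`SymDyn.mem_blockLanguage_of_long_past`), and the infinite future is automatic.

The finite orbits are described by a letter-to-letter transducer that reads the maps, keeps the
current element of the alphabet as its state, and writes either the state or a padding letter. Its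
image `K` of the context-free language of the functional shift is context-free, by the usual
triple construction (`Language.IsContextFree.transduce`). With `padded m w` the word `w` preceded
by `m` padding letters, `w` occurs in the generated shift if and only if `padded m w ∈ K` for
infinitely many `m` (`SymDyn.mem_blockLanguage_generatedShift_iff`).

It remains to see that the set of these `w` is context-free for every context-free language `K`
(`Language.IsContextFree.dropPadding`). A parse tree of `padded m w` has a path from the root along
the border between the padding and the word; subtrees to its left produce only padding, those to
its right only letters of `w`. The steps along this path form a finite graph with vertices
(nonterminal, prefix of `w`) and with the number of padding letters as weight. If the total weight
is unbounded, then a single step has unbounded weight, or there is a cycle of positive weight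
(`WeightedGraph.of_infinite_total`). A cycle does not shorten the prefix of `w`, so it derives
nothing but padding around its nonterminal, and it can be repeated whatever word that nonterminal
has to produce. Both causes depend only on the grammar and not on `w`, so a grammar for the desired
language has to guess one of them at some point of the path and can ignore the padding otherwise.
-/

/-! ### Big-step derivations in context-free grammars -/

namespace ContextFreeGrammar

variable {T : Type*}

/-- `g.Yields s w`: the sentential form `s` derives the terminal word `w`. Unlike
`ContextFreeGrammar.Derives`, the derivation is organised as a forest of parse trees, one for each
symbol of `s`. -/
inductive Yields (g : ContextFreeGrammar T) : List (Symbol T g.NT) → List T → Prop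
  | nil : Yields g [] []
  | terminal (t : T) {s : List (Symbol T g.NT)} {w : List T} (h : Yields g s w) :
      Yields g (Symbol.terminal t :: s) (t :: w)
  | nonterminal {r : ContextFreeRule T g.NT} (hr : r ∈ g.rules) {u : List T}
      (hu : Yields g r.output u) {s : List (Symbol T g.NT)} {w : List T} (h : Yields g s w) :
      Yields g (Symbol.nonterminal r.input :: s) (u ++ w)

variable {g : ContextFreeGrammar T}

theorem Yields.append {s₁ s₂ : List (Symbol T g.NT)} {w₁ w₂ : List T} (h₁ : g.Yields s₁ w₁)
    (h₂ : g.Yields s₂ w₂) : g.Yields (s₁ ++ s₂) (w₁ ++ w₂) := by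
  induction h₁ with
  | nil => exact h₂
  | terminal t _ ih => exact .terminal t ih
  | nonterminal hr hu _ _ ih => simpa using Yields.nonterminal hr hu ih

theorem Yields.of_rule {r : ContextFreeRule T g.NT} (hr : r ∈ g.rules) {u : List T}
    (hu : g.Yields r.output u) : g.Yields [.nonterminal r.input] u := by
  simpa using Yields.nonterminal hr hu .nil

theorem Yields.exists_rule {n : g.NT} {w : List T} (h : g.Yields [.nonterminal n] w) :
    ∃ r ∈ g.rules, r.input = n ∧ g.Yields r.output w := by
  cases h with
  | nonterminal hr hu h =>
    cases h
    exact ⟨_, hr, rfl, by simpa using hu⟩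

theorem Yields.exists_append {s₁ s₂ : List (Symbol T g.NT)} {w : List T}
    (h : g.Yields (s₁ ++ s₂) w) :
    ∃ w₁ w₂, w = w₁ ++ w₂ ∧ g.Yields s₁ w₁ ∧ g.Yields s₂ w₂ := by
  induction s₁ generalizing w with
  | nil => exact ⟨[], w, rfl, .nil, h⟩
  | cons x s₁ ih =>
    cases h with
    | terminal t h =>
      obtain ⟨w₁, w₂, rfl, h₁, h₂⟩ := ih h
      exact ⟨t :: w₁, w₂, rfl, .terminal t h₁, h₂⟩
    | nonterminal hr hu h =>
      obtain ⟨w₁, w₂, rfl, h₁, h₂⟩ := ih h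
      exact ⟨_ ++ w₁, w₂, by simp, .nonterminal hr hu h₁, h₂⟩

theorem Yields.of_produces {s s' : List (Symbol T g.NT)} {w : List T} (h : g.Produces s s')
    (hw : g.Yields s' w) : g.Yields s w := by
  obtain ⟨r, hr, h⟩ := h
  obtain ⟨p, q, rfl, rfl⟩ := h.exists_parts
  obtain ⟨w', w₃, rfl, hw', h₃⟩ := hw.exists_append
  obtain ⟨w₁, w₂, rfl, h₁, h₂⟩ := hw'.exists_append
  exact (h₁.append (.of_rule hr h₂)).append h₃

theorem yields_map_terminal (w : List T) : g.Yields (w.map .terminal) w := by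
  induction w with
  | nil => exact .nil
  | cons t w ih => exact .terminal t ih

theorem Yields.derives {s : List (Symbol T g.NT)} {w : List T} (h : g.Yields s w) :
    g.Derives s (w.map .terminal) := by
  induction h with
  | nil => exact .refl _
  | terminal t _ ih => exact ih.append_left [_]
  | @nonterminal r hr u _ s w _ ihu ih =>
    have h₁ : g.Produces [.nonterminal r.input] r.output := ⟨r, hr, .input_output⟩
    have h₂ := ((h₁.trans_derives ihu).append_right s).trans (ih.append_left _)
    simpa using h₂

theorem yields_iff_derives {s : List (Symbol T g.NT)} {w : List T} :
    g.Yields s w ↔ g.Derives s (w.map .terminal) := by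
  refine ⟨Yields.derives, fun h => ?_⟩
  induction h using Relation.ReflTransGen.head_induction_on with
  | refl => exact yields_map_terminal w
  | head h _ ih => exact ih.of_produces h

theorem mem_language_iff_yields {w : List T} :
    w ∈ g.language ↔ g.Yields [.nonterminal g.initial] w :=
  yields_iff_derives.symm

/-- The language denoted by a sentential form when each nonterminal `n` denotes `I n`. -/
def interp {N : Type*} (I : N → Language T) : List (Symbol T N) → Language T
  | [] => 1
  | .terminal t :: s => {[t]} * interp I s
  | .nonterminal n :: s => I n * interp I s

/-- The languages of the nonterminals form the least family closed under the rules: if `I` is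
closed under the rules, then every word derived from `s` lies in the interpretation of `s`. -/
theorem Yields.mem_interp {I : g.NT → Language T}
    (hI : ∀ r ∈ g.rules, ∀ w ∈ interp I r.output, w ∈ I r.input)
    {s : List (Symbol T g.NT)} {w : List T} (h : g.Yields s w) : w ∈ interp I s := by
  induction h with
  | nil => exact rfl
  | terminal t _ ih => exact Language.mem_mul.2 ⟨[t], rfl, _, ih, rfl⟩
  | nonterminal hr _ _ ihu ih => exact Language.mem_mul.2 ⟨_, hI _ hr _ ihu, _, ih, rfl⟩

theorem Yields.mem_of_closed {I : g.NT → Language T}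
    (hI : ∀ r ∈ g.rules, ∀ w ∈ interp I r.output, w ∈ I r.input)
    {n : g.NT} {w : List T} (h : g.Yields [.nonterminal n] w) : w ∈ I n := by
  simpa [interp] using h.mem_interp hI

/-! ### Letter-to-letter transductions -/

/-- `Run δ q v o q'`: the letter-to-letter transducer with transition relation `δ` can go from
state `q` to state `q'` while reading `v` and writing `o`. -/
inductive Run {Q O : Type*} (δ : Q → T → O → Q → Prop) : Q → List T → List O → Q → Prop
  | nil (q : Q) : Run δ q [] [] q
  | cons {q q' q'' : Q} {t : T} {x : O} {v : List T} {o : List O} (ht : δ q t x q')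
      (h : Run δ q' v o q'') : Run δ q (t :: v) (x :: o) q''

variable {Q : Type} {O : Type*} {δ : Q → T → O → Q → Prop}

theorem Run.append {q q' q'' : Q} {v₁ v₂ : List T} {o₁ o₂ : List O} (h₁ : Run δ q v₁ o₁ q')
    (h₂ : Run δ q' v₂ o₂ q'') : Run δ q (v₁ ++ v₂) (o₁ ++ o₂) q'' := by
  induction h₁ with
  | nil => exact h₂
  | cons ht _ ih => exact .cons ht (ih h₂)

theorem Run.exists_append {q q'' : Q} {v₁ v₂ : List T} {o : List O}
    (h : Run δ q (v₁ ++ v₂) o q'') :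
    ∃ q' o₁ o₂, o = o₁ ++ o₂ ∧ Run δ q v₁ o₁ q' ∧ Run δ q' v₂ o₂ q'' := by
  induction v₁ generalizing q o with
  | nil => exact ⟨q, [], o, rfl, .nil q, h⟩
  | cons t v₁ ih =>
    cases h with
    | cons ht h =>
      obtain ⟨q', o₁, o₂, rfl, h₁, h₂⟩ := ih h
      exact ⟨q', _ :: o₁, o₂, rfl, .cons ht h₁, h₂⟩

/-- Runs on sentential forms: terminals are replaced by an output letter of a transition, and a
nonterminal `n` crossed between the states `q` and `q'` becomes the nonterminal `(q, n, q')`. -/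
inductive SymbolRun {N : Type} (δ : Q → T → O → Q → Prop) :
    Q → List (Symbol T N) → List (Symbol O (Option (Q × N × Q))) → Q → Prop
  | nil (q : Q) : SymbolRun δ q [] [] q
  | terminal {q q' q'' : Q} {t : T} {x : O} {s s'} (ht : δ q t x q')
      (h : SymbolRun δ q' s s' q'') :
      SymbolRun δ q (.terminal t :: s) (.terminal x :: s') q''
  | nonterminal (q : Q) {q' q'' : Q} (n : N) {s s'} (h : SymbolRun δ q' s s' q'') :
      SymbolRun δ q (.nonterminal n :: s) (.nonterminal (some (q, n, q')) :: s') q''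

theorem finite_symbolRun [Finite Q] [Finite O] {N : Type} (δ : Q → T → O → Q → Prop) (q : Q)
    (s : List (Symbol T N)) :
    {p : List (Symbol O (Option (Q × N × Q))) × Q | SymbolRun δ q s p.1 p.2}.Finite := by
  induction s generalizing q with
  | nil =>
    refine (Set.finite_singleton ([], q)).subset ?_
    rintro ⟨s', q'⟩ h
    cases h
    rfl
  | cons x s ih =>
    cases x with
    | terminal t =>
      refine (Set.finite_iUnion fun y : O => Set.finite_iUnion fun q' : Q =>
        (ih q').image fun p => (.terminal y :: p.1, p.2)).subset ?_
      rintro ⟨s', q''⟩ h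
      cases h with
      | terminal ht h => exact Set.mem_iUnion₂.2 ⟨_, _, (_, q''), h, rfl⟩
    | nonterminal n =>
      refine (Set.finite_iUnion fun q' : Q =>
        (ih q').image fun p => (.nonterminal (some (q, n, q')) :: p.1, p.2)).subset ?_
      rintro ⟨s', q''⟩ h
      cases h with
      | nonterminal _ _ h => exact Set.mem_iUnion.2 ⟨_, (_, q''), h, rfl⟩

/-- The rules of the grammar for the image of `g.language` under a transducer. The nonterminal
`(q, n, q')` generates the outputs of the runs from `q` to `q'` on words generated by `n`; the
fresh initial nonterminal `none` guesses the initial and the final state. -/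
def transduceRules (g : ContextFreeGrammar T) (δ : Q → T → O → Q → Prop) (I F : Set Q) :
    Set (ContextFreeRule O (Option (Q × g.NT × Q))) :=
  {ρ | (∃ r ∈ g.rules, ∃ q q', ρ.input = some (q, r.input, q') ∧
      SymbolRun δ q r.output ρ.output q') ∨
    ∃ q ∈ I, ∃ q' ∈ F, ρ = ⟨none, [.nonterminal (some (q, g.initial, q'))]⟩}

theorem finite_transduceRules [Finite Q] [Finite O] (g : ContextFreeGrammar T)
    (δ : Q → T → O → Q → Prop) (I F : Set Q) : (g.transduceRules δ I F).Finite := by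
  refine Set.Finite.union ?_ ?_
  · refine (g.rules.finite_toSet.biUnion fun r _ => Set.finite_iUnion fun q : Q =>
      (finite_symbolRun δ q r.output).image fun p =>
        (⟨some (q, r.input, p.2), p.1⟩ :
          ContextFreeRule O (Option (Q × g.NT × Q)))).subset ?_
    rintro ⟨n, o⟩ ⟨r, hr, q, q', rfl, h⟩
    exact Set.mem_iUnion₂.2 ⟨r, hr, Set.mem_iUnion.2 ⟨q, (o, q'), h, rfl⟩⟩
  · refine (Set.finite_range fun p : Q × Q =>
      (⟨none, [.nonterminal (some (p.1, g.initial, p.2))]⟩ :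
        ContextFreeRule O (Option (Q × g.NT × Q)))).subset ?_
    rintro _ ⟨q, _, q', _, rfl⟩
    exact ⟨(q, q'), rfl⟩

/-- The grammar for the image of `g.language` under the transducer with transitions `δ`, initial
states `I` and final states `F`. -/
noncomputable def transduce [Finite Q] [Finite O] (g : ContextFreeGrammar T)
    (δ : Q → T → O → Q → Prop) (I F : Set Q) : ContextFreeGrammar O where
  NT := Option (Q × g.NT × Q)
  initial := none
  rules := (g.finite_transduceRules δ I F).toFinset

theorem mem_rules_transduce [Finite Q] [Finite O] {I F : Set Q}
    {ρ : ContextFreeRule O (Option (Q × g.NT × Q))} :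
    ρ ∈ (g.transduce δ I F).rules ↔ ρ ∈ g.transduceRules δ I F :=
  Set.Finite.mem_toFinset _

/-- Completeness of the triple construction. -/
theorem Yields.exists_symbolRun [Finite Q] [Finite O] {I F : Set Q} {s : List (Symbol T g.NT)}
    {v : List T} (h : g.Yields s v) {q q' : Q} {o : List O} (hrun : Run δ q v o q') :
    ∃ s', SymbolRun δ q s s' q' ∧ (g.transduce δ I F).Yields s' o := by
  induction h generalizing q q' o with
  | nil =>
    cases hrun
    exact ⟨[], .nil q, .nil⟩
  | terminal t _ ih =>
    cases hrun with
    | cons ht hrun =>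
      obtain ⟨s', hs', hy⟩ := ih hrun
      exact ⟨_, .terminal ht hs', .terminal _ hy⟩
  | @nonterminal r hr u _ s w _ ihu ih =>
    obtain ⟨q₁, o₁, o₂, rfl, h₁, h₂⟩ := hrun.exists_append
    obtain ⟨s₁, hs₁, hy₁⟩ := ihu h₁
    obtain ⟨s₂, hs₂, hy₂⟩ := ih h₂
    refine ⟨_, .nonterminal q r.input hs₂, ?_⟩
    exact Yields.nonterminal (g := g.transduce δ I F) (r := ⟨some (q, r.input, q₁), s₁⟩)
      (mem_rules_transduce.2 (.inl ⟨r, hr, q, q₁, rfl, hs₁⟩)) hy₁ hy₂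

/-- The intended languages of the nonterminals of `g.transduce δ I F`. -/
def transduceLanguage (g : ContextFreeGrammar T) (δ : Q → T → O → Q → Prop) (I F : Set Q) :
    Option (Q × g.NT × Q) → Language O
  | none => {o | ∃ v ∈ g.language, ∃ q ∈ I, ∃ q' ∈ F, Run δ q v o q'}
  | some (q, n, q') => {o | ∃ v, g.Yields [.nonterminal n] v ∧ Run δ q v o q'}

/-- Soundness of the triple construction. -/
theorem SymbolRun.exists_run {I F : Set Q} {q q' : Q} {s : List (Symbol T g.NT)}
    {s' : List (Symbol O (Option (Q × g.NT × Q)))} (h : SymbolRun δ q s s' q') {o : List O}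
    (ho : o ∈ interp (g.transduceLanguage δ I F) s') :
    ∃ v, g.Yields s v ∧ Run δ q v o q' := by
  induction h generalizing o with
  | nil q =>
    obtain rfl : o = [] := ho
    exact ⟨[], .nil, .nil q⟩
  | terminal ht _ ih =>
    obtain ⟨_, rfl, o, ho', rfl⟩ := Language.mem_mul.1 ho
    obtain ⟨v, hv, hrun⟩ := ih ho'
    exact ⟨_, .terminal _ hv, .cons ht hrun⟩
  | nonterminal q n _ ih =>
    obtain ⟨o₁, ⟨v₁, hv₁, hrun₁⟩, o, ho', rfl⟩ := Language.mem_mul.1 ho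
    obtain ⟨v, hv, hrun⟩ := ih ho'
    exact ⟨_, hv₁.append hv, hrun₁.append hrun⟩

end ContextFreeGrammar

open ContextFreeGrammar in
/-- Context-free languages are closed under letter-to-letter finite-state transductions. -/
theorem Language.IsContextFree.transduce {T O : Type*} {Q : Type} [Finite Q] [Finite O]
    {L : Language T} (hL : L.IsContextFree) (δ : Q → T → O → Q → Prop) (I F : Set Q) :
    Language.IsContextFree
      ({o | ∃ v ∈ L, ∃ q ∈ I, ∃ q' ∈ F, Run δ q v o q'} : Language O) := by
  obtain ⟨g, rfl⟩ := hL
  refine ⟨g.transduce δ I F, Set.ext fun o => ⟨fun h => ?_, ?_⟩⟩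
  · refine (mem_language_iff_yields.1 h).mem_of_closed (I := g.transduceLanguage δ I F) ?_
    intro ρ hρ w hw
    obtain ⟨r, hr, q, q', hin, hrun⟩ | ⟨q, hq, q', hq', rfl⟩ := mem_rules_transduce.1 hρ
    · obtain ⟨v, hv, hv'⟩ := hrun.exists_run hw
      rw [hin]
      exact ⟨v, .of_rule hr hv, hv'⟩
    · obtain ⟨v, hv, hrun⟩ : w ∈ g.transduceLanguage δ I F (some (q, g.initial, q')) := by
        simpa [interp] using hw
      exact ⟨v, mem_language_iff_yields.2 hv, q, hq, q', hq', hrun⟩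
  · rintro ⟨v, hv, q, hq, q', hq', hrun⟩
    obtain ⟨s', hs', hy⟩ := (mem_language_iff_yields.1 hv).exists_symbolRun (I := I) (F := F) hrun
    refine mem_language_iff_yields.2 (Yields.of_rule (g := g.transduce δ I F)
      (mem_rules_transduce.2 (.inr ⟨q, hq, q', hq', rfl⟩)) ?_)
    cases hs' with
    | nonterminal _ _ h =>
      cases h
      exact hy

/-! ### Total weights in a finite weighted graph -/

namespace WeightedGraph

variable {α : Type*}

/-- `Total D E x m`: there is a walk from `x` along edges `E y j z` of weight `j`, stopped at some
vertex `y` at a final cost `d` with `D y d`, whose weights and final cost add up to `m`. -/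
inductive Total (D : α → ℕ → Prop) (E : α → ℕ → α → Prop) : α → ℕ → Prop
  | base {x : α} {d : ℕ} (h : D x d) : Total D E x d
  | step {x y : α} {j m : ℕ} (h : E x j y) (hy : Total D E y m) : Total D E x (j + m)

/-- `Reach E x k y`: there is a walk of total weight `k` from `x` to `y`. -/
inductive Reach (E : α → ℕ → α → Prop) : α → ℕ → α → Prop
  | refl (x : α) : Reach E x 0 x
  | step {x y z : α} {j k : ℕ} (h : E x j y) (hy : Reach E y k z) : Reach E x (j + k) z

variable {D : α → ℕ → Prop} {E : α → ℕ → α → Prop}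

theorem Reach.trans {x y z : α} {j k : ℕ} (h₁ : Reach E x j y) (h₂ : Reach E y k z) :
    Reach E x (j + k) z := by
  induction h₁ with
  | refl => simpa using h₂
  | step h _ ih => simpa [add_assoc] using Reach.step h (ih h₂)

theorem Reach.of_edge {x y : α} {j : ℕ} (h : E x j y) : Reach E x j y := by
  simpa using Reach.step h (.refl y)

/-- If a vertex of a finite weighted graph admits infinitely many total weights, then some vertex
reached from it has infinitely many final costs, or is the source of parallel edges of infinitely
many weights, or lies on a cycle of positive weight. The conclusion is phrased for a predicate `P`
that holds at these three kinds of vertices and is inherited backwards along edges. -/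
theorem of_infinite_total {S : Set α} (hS : S.Finite)
    (hSE : ∀ x ∈ S, ∀ j y m, E x j y → Total D E y m → y ∈ S) {P : α → Prop}
    (hD : ∀ x ∈ S, {d | D x d}.Infinite → P x)
    (hE : ∀ x ∈ S, ∀ y ∈ S, ∀ m, {j | E x j y}.Infinite → Total D E y m → P x)
    (hstep : ∀ x ∈ S, ∀ j y, E x j y → P y → P x)
    (hcyc : ∀ x ∈ S, ∀ k m, 0 < k → Reach E x k x → Total D E x m → P x)
    {x : α} (hx : x ∈ S) (hinf : {m | Total D E x m}.Infinite) : P x := by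
  by_contra hPx
  set B : Set α := {y ∈ S | ¬ P y ∧ ∃ m, Total D E y m} with hB
  have hBfin : B.Finite := hS.subset fun y hy => hy.1
  have hBE : ∀ y ∈ B, ∀ j z m, E y j z → Total D E z m → z ∈ B := fun y hy j z m hyz hz =>
    ⟨hSE y hy.1 j z m hyz hz, fun hPz => hy.2.1 (hstep y hy.1 j z hyz hPz), m, hz⟩
  -- Uniform bounds for the final costs and for the edge weights inside `B`.
  obtain ⟨d₀, hd₀⟩ : BddAbove (⋃ y ∈ B, {d | D y d}) :=
    (hBfin.biUnion fun y hy => by_contra fun h => hy.2.1 (hD y hy.1 h)).bddAbove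
  obtain ⟨j₀, hj₀⟩ : BddAbove (⋃ y ∈ B, ⋃ z ∈ B, {j | E y j z}) := by
    refine (hBfin.biUnion fun y hy => hBfin.biUnion fun z hz => ?_).bddAbove
    by_contra h
    obtain ⟨m, hm⟩ := hz.2.2
    exact hy.2.1 (hE y hy.1 z hz.1 m h hm)
  -- Without positive cycles, reachability at positive weight is a well-founded order on `B`.
  have hwf : WellFounded fun z y : B => ∃ k, 0 < k ∧ Reach E (y : α) k z := by
    have := hBfin.to_subtype
    have htrans : IsTrans B fun z y => ∃ k, 0 < k ∧ Reach E (y : α) k z :=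
      ⟨fun _ _ _ ⟨j, hj, h₁⟩ ⟨k, hk, h₂⟩ => ⟨k + j, by omega, h₂.trans h₁⟩⟩
    have hirr : Std.Irrefl fun z y : B => ∃ k, 0 < k ∧ Reach E (y : α) k z :=
      ⟨fun y ⟨k, hk, h⟩ => by
        obtain ⟨m, hm⟩ := y.2.2.2
        exact y.2.2.1 (hcyc y y.2.1 k m hk h hm)⟩
    exact Finite.wellFounded_of_trans_of_irrefl _
  have hbdd : ∀ y : B, BddAbove {m | Total D E (y : α) m} := fun y => by
    induction y using hwf.induction with
    | _ y ih =>
      -- The bound `b` serves all vertices that are reached from `y` at positive weight.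
      obtain ⟨b, hb⟩ : BddAbove (⋃ z ∈ {z : B | ∃ k, 0 < k ∧ Reach E (y : α) k z},
          {m | Total D E (z : α) m}) := by
        have := hBfin.to_subtype
        exact (Set.finite_univ.subset (Set.subset_univ _)).bddAbove_biUnion.2 fun z hz => ih z hz
      -- Follow the walk along edges of weight zero up to its first edge of positive weight.
      have key : ∀ z m, Total D E z m → z ∈ B → Reach E (y : α) 0 z → m ≤ d₀ + j₀ + b := by
        intro z m h
        induction h with
        | @base z d h =>
          intro hz _
          have := hd₀ (Set.mem_iUnion₂.2 ⟨z, hz, h⟩)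
          omega
        | @step z z' j m h hz' ih' =>
          intro hz hyz
          have hzB := hBE z hz j z' m h hz'
          have hyz' := hyz.trans (.of_edge h)
          rw [zero_add] at hyz'
          rcases Nat.eq_zero_or_pos j with rfl | hj
          · simpa using ih' hzB hyz'
          · have h₁ := hj₀ (Set.mem_iUnion₂.2 ⟨z, hz, Set.mem_iUnion₂.2 ⟨z', hzB, h⟩⟩)
            have h₂ := hb (Set.mem_iUnion₂.2 ⟨⟨z', hzB⟩, ⟨j, hj, hyz'⟩, hz'⟩)
            omega
      exact ⟨_, fun m hm => key y m hm y.2 (.refl _)⟩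
  obtain ⟨m, hm⟩ := hinf.nonempty
  exact hinf (Set.finite_Iic _ |>.subset fun k hk =>
    (hbdd ⟨x, hx, hPx, m, hm⟩).choose_spec hk)

end WeightedGraph

/-! ### Unbounded prefixes of a padding letter -/

namespace ContextFreeGrammar

variable {T : Type*}

/-- The word `w` preceded by `m` copies of the padding letter `none`. -/
def padded (m : ℕ) (w : List T) : List (Option T) := List.replicate m none ++ w.map some

theorem replicate_append_padded (j m : ℕ) (w : List T) :
    List.replicate j none ++ padded m w = padded (j + m) w := by
  rw [padded, padded, List.replicate_add, List.append_assoc]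

theorem padded_append_map_some (m : ℕ) (w₁ w₂ : List T) :
    padded m w₁ ++ w₂.map some = padded m (w₁ ++ w₂) := by
  simp [padded]

theorem append_eq_padded {u v : List (Option T)} {m : ℕ} {w : List T}
    (h : u ++ v = padded m w) :
    (∃ w₁ w₂, w = w₁ ++ w₂ ∧ u = padded m w₁ ∧ v = w₂.map some) ∨
    ∃ j k, m = j + k ∧ u = List.replicate j none ∧ v = padded k w := by
  induction m generalizing u with
  | zero =>
    obtain ⟨w₁, w₂, rfl, rfl, rfl⟩ := List.map_eq_append_iff.1 (by simpa [padded] using h.symm)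
    exact .inl ⟨w₁, w₂, rfl, by simp [padded], rfl⟩
  | succ m ih =>
    have hm : padded (m + 1) w = none :: padded m w := by simp [padded, List.replicate_succ]
    cases u with
    | nil => exact .inr ⟨0, m + 1, by simp, rfl, h⟩
    | cons x u =>
      rw [hm, List.cons_append, List.cons.injEq] at h
      obtain ⟨rfl, h⟩ := h
      rcases ih h with ⟨w₁, w₂, rfl, rfl, rfl⟩ | ⟨j, k, rfl, rfl, rfl⟩
      · exact .inl ⟨w₁, w₂, rfl, by simp [padded, List.replicate_succ], rfl⟩
      · exact .inr ⟨j + 1, k, by omega, by simp [List.replicate_succ], rfl⟩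

variable (g : ContextFreeGrammar (Option T))

/-- The number of padding letters produced when the derivation of a padded word `p.2` from the
nonterminal `p.1` uses a rule at which the padding and the word separate: `s₁` produces all the
padding and `s₂` the whole word. -/
def EndCost (p : g.NT × List T) (d : ℕ) : Prop :=
  ∃ r ∈ g.rules, r.input = p.1 ∧ ∃ s₁ s₂, s₁ ++ s₂ = r.output ∧
    g.Yields s₁ (List.replicate d none) ∧ g.Yields s₂ (p.2.map some)

/-- A step along the path of a parse tree that separates the padding from the word: a rule for
`p.1` is applied, `s₁` produces `j` padding letters, `s₂` produces the end of the word, and the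
nonterminal `q.1` between them has to produce the remaining padding and the remaining word
`q.2`. -/
def Edge (p : g.NT × List T) (j : ℕ) (q : g.NT × List T) : Prop :=
  ∃ r ∈ g.rules, r.input = p.1 ∧ ∃ s₁ s₂, s₁ ++ .nonterminal q.1 :: s₂ = r.output ∧
    g.Yields s₁ (List.replicate j none) ∧ ∃ w, p.2 = q.2 ++ w ∧ g.Yields s₂ (w.map some)

variable {g}

open WeightedGraph

theorem Edge.yields {p q : g.NT × List T} {j : ℕ} (h : g.Edge p j q) :
    ∃ w, p.2 = q.2 ++ w ∧ ∀ m v, g.Yields [.nonterminal q.1] (padded m v) →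
      g.Yields [.nonterminal p.1] (padded (j + m) (v ++ w)) := by
  obtain ⟨r, hr, hp, s₁, s₂, hs, h₁, w, hw, h₂⟩ := h
  refine ⟨w, hw, fun m v hv => ?_⟩
  rw [← hp, ← padded_append_map_some, ← replicate_append_padded]
  refine .of_rule hr ?_
  rw [← hs]
  simpa using h₁.append (hv.append h₂)

/-- A walk in the graph is a derivation with `k` padding letters on the left and the part of the
word by which the prefix is shortened on the right. It applies to every padded word `padded m v`
derived from the end of the walk, not only to the prefix recorded there. -/
theorem yields_of_reach {p q : g.NT × List T} {k : ℕ} (h : Reach g.Edge p k q) :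
    ∃ w, p.2 = q.2 ++ w ∧ ∀ m v, g.Yields [.nonterminal q.1] (padded m v) →
      g.Yields [.nonterminal p.1] (padded (k + m) (v ++ w)) := by
  induction h with
  | refl p => exact ⟨[], by simp, fun m v h => by simpa using h⟩
  | step h _ ih =>
    obtain ⟨w₁, hw₁, h₁⟩ := h.yields
    obtain ⟨w₂, hw₂, h₂⟩ := ih
    refine ⟨w₂ ++ w₁, by simp [hw₁, hw₂], fun m v hv => ?_⟩
    simpa [add_assoc] using h₁ _ _ (h₂ m v hv)

theorem yields_of_total {p : g.NT × List T} {m : ℕ} (h : Total g.EndCost g.Edge p m) :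
    g.Yields [.nonterminal p.1] (padded m p.2) := by
  induction h with
  | base h =>
    obtain ⟨r, hr, hp, s₁, s₂, hs, h₁, h₂⟩ := h
    rw [← hp]
    refine .of_rule hr ?_
    rw [← hs]
    exact h₁.append h₂
  | step h _ ih =>
    obtain ⟨w, hw, h⟩ := h.yields
    rw [hw]
    exact h _ _ ih

/-- The two ways in which `s` can derive `padded m w`: either `s` splits between the padding and the
word, or the border lies inside the word derived from one nonterminal of `s`. -/
def PaddedCases (g : ContextFreeGrammar (Option T)) (s : List (Symbol (Option T) g.NT)) (m : ℕ)
    (w : List T) : Prop :=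
  (∃ s₁ s₂, s₁ ++ s₂ = s ∧ g.Yields s₁ (List.replicate m none) ∧ g.Yields s₂ (w.map some)) ∨
    ∃ s₁ n s₂ j k w₁ w₂, s₁ ++ .nonterminal n :: s₂ = s ∧ m = j + k ∧ w = w₁ ++ w₂ ∧
      g.Yields s₁ (List.replicate j none) ∧ Total g.EndCost g.Edge (n, w₁) k ∧
      g.Yields s₂ (w₂.map some)

theorem total_of_padded_cases {r : ContextFreeRule (Option T) g.NT} (hr : r ∈ g.rules) {m : ℕ}
    {w : List T} (h : g.PaddedCases r.output m w) :
    Total g.EndCost g.Edge (r.input, w) m := by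
  obtain ⟨s₁, s₂, hs, h₁, h₂⟩ | ⟨s₁, n, s₂, j, k, w₁, w₂, hs, rfl, rfl, h₁, hn, h₂⟩ := h
  · exact .base ⟨r, hr, rfl, s₁, s₂, hs, h₁, h₂⟩
  · exact .step ⟨r, hr, rfl, s₁, s₂, hs, h₁, w₂, rfl, h₂⟩ hn

theorem Yields.padded_cases {s : List (Symbol (Option T) g.NT)} {v : List (Option T)}
    (h : g.Yields s v) {m : ℕ} {w : List T} (hv : v = padded m w) :
    g.PaddedCases s m w := by
  induction h generalizing m w with
  | nil =>
    obtain ⟨h₁, h₂⟩ := List.append_eq_nil_iff.1 hv.symm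
    exact .inl ⟨[], [], rfl, by rw [h₁]; exact .nil, by rw [h₂]; exact .nil⟩
  | @terminal t s v h ih =>
    cases m with
    | zero =>
      refine .inl ⟨[], _, rfl, .nil, ?_⟩
      rw [padded, List.replicate_zero, List.nil_append] at hv
      rw [← hv]
      exact .terminal t h
    | succ m =>
      rw [padded, List.replicate_succ, List.cons_append, List.cons.injEq] at hv
      obtain ⟨rfl, hv⟩ := hv
      obtain ⟨s₁, s₂, rfl, h₁, h₂⟩ | ⟨s₁, n, s₂, j, k, w₁, w₂, rfl, rfl, rfl, h₁, hn, h₂⟩ := ih hv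
      · exact .inl ⟨_ :: s₁, s₂, rfl, .terminal _ h₁, h₂⟩
      · exact .inr ⟨_ :: s₁, n, s₂, j + 1, k, w₁, w₂, rfl, by omega, rfl, .terminal _ h₁, hn, h₂⟩
  | @nonterminal r hr u hu s v h ihu ih =>
    obtain ⟨w₁, w₂, rfl, hu', rfl⟩ | ⟨j, k, rfl, rfl, hv'⟩ := append_eq_padded hv
    · exact .inr ⟨[], r.input, s, 0, m, w₁, w₂, rfl, by simp, rfl, .nil,
        total_of_padded_cases hr (ihu hu'), h⟩
    · obtain ⟨s₁, s₂, rfl, h₁, h₂⟩ | ⟨s₁, n, s₂, i, k, w₁, w₂, rfl, rfl, rfl, h₁, hn, h₂⟩ := ih hv'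
      · refine .inl ⟨_ :: s₁, s₂, rfl, ?_, h₂⟩
        rw [List.replicate_add]
        exact .nonterminal hr hu h₁
      · refine .inr ⟨_ :: s₁, n, s₂, j + i, k, w₁, w₂, rfl, by omega, rfl, ?_, hn, h₂⟩
        rw [List.replicate_add]
        exact .nonterminal hr hu h₁

/-- The total weights at `(n, w)` are the lengths of the paddings with which `n` derives `w`. -/
theorem total_iff_yields {n : g.NT} {m : ℕ} {w : List T} :
    Total g.EndCost g.Edge (n, w) m ↔ g.Yields [.nonterminal n] (padded m w) := by
  refine ⟨yields_of_total, fun h => ?_⟩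
  obtain ⟨r, hr, rfl, hout⟩ := h.exists_rule
  exact total_of_padded_cases hr (hout.padded_cases rfl)

/-- The nonterminals of the grammar `g.dropPadding`. For a nonterminal `n` of `g`, `word n`
generates the words without padding derived from `n`, `mixed n` the words `w` such that `n`
derives some padding followed by `w`, and `unbounded n` the words `w` such that `n` derives
arbitrarily long paddings followed by `w`. Nothing is derived from `dead`. -/
inductive PaddingNT (N : Type) : Type
  | word (n : N)
  | mixed (n : N)
  | unbounded (n : N)
  | dead

/-- Translation of a symbol that must not produce padding. -/
def unpad {N : Type} : Symbol (Option T) N → Symbol T (PaddingNT N)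
  | .terminal (some t) => .terminal t
  | .terminal none => .nonterminal .dead
  | .nonterminal n => .nonterminal (.word n)

/-- The rules of `g.dropPadding`. The last three constructors are the reasons why the length of
the padding is unbounded: one part of a rule produces paddings of infinitely many lengths, and a
nonterminal that can be pumped can prolong each padding by `k > 0`. -/
inductive PaddingRule (g : ContextFreeGrammar (Option T)) :
    ContextFreeRule T (PaddingNT g.NT) → Prop
  | word {r} (hr : r ∈ g.rules) : PaddingRule g ⟨.word r.input, r.output.map unpad⟩
  | mixed_end {r} (hr : r ∈ g.rules) {s₁ s₂} (hs : s₁ ++ s₂ = r.output) {d : ℕ}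
      (h : g.Yields s₁ (List.replicate d none)) :
      PaddingRule g ⟨.mixed r.input, s₂.map unpad⟩
  | mixed_step {r} (hr : r ∈ g.rules) {s₁ n s₂} (hs : s₁ ++ .nonterminal n :: s₂ = r.output)
      {d : ℕ} (h : g.Yields s₁ (List.replicate d none)) :
      PaddingRule g ⟨.mixed r.input, .nonterminal (.mixed n) :: s₂.map unpad⟩
  | unbounded_step {r} (hr : r ∈ g.rules) {s₁ n s₂} (hs : s₁ ++ .nonterminal n :: s₂ = r.output)
      {d : ℕ} (h : g.Yields s₁ (List.replicate d none)) :
      PaddingRule g ⟨.unbounded r.input, .nonterminal (.unbounded n) :: s₂.map unpad⟩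
  | unbounded_end {r} (hr : r ∈ g.rules) {s₁ s₂} (hs : s₁ ++ s₂ = r.output)
      (h : {d : ℕ | g.Yields s₁ (List.replicate d none)}.Infinite) :
      PaddingRule g ⟨.unbounded r.input, s₂.map unpad⟩
  | unbounded_mixed {r} (hr : r ∈ g.rules) {s₁ n s₂} (hs : s₁ ++ .nonterminal n :: s₂ = r.output)
      (h : {d : ℕ | g.Yields s₁ (List.replicate d none)}.Infinite) :
      PaddingRule g ⟨.unbounded r.input, .nonterminal (.mixed n) :: s₂.map unpad⟩
  | pump {r} (hr : r ∈ g.rules) {k : ℕ} (hk : 0 < k)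
      (h : ∀ m v, g.Yields [.nonterminal r.input] (padded m v) →
        g.Yields [.nonterminal r.input] (padded (k + m) v)) :
      PaddingRule g ⟨.unbounded r.input, [.nonterminal (.mixed r.input)]⟩

theorem finite_splits {α : Type*} (l : List α) : {p : List α × List α | p.1 ++ p.2 = l}.Finite := by
  refine ((l.inits.finite_toSet).prod (l.tails.finite_toSet)).subset ?_
  rintro ⟨l₁, l₂⟩ rfl
  exact ⟨(List.mem_inits _ _).2 (List.prefix_append _ _),
    (List.mem_tails _ _).2 (List.suffix_append _ _)⟩

theorem finite_nonterminal_splits {N : Type*} (s : List (Symbol T N)) :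
    {p : List (Symbol T N) × N × List (Symbol T N) |
      p.1 ++ .nonterminal p.2.1 :: p.2.2 = s}.Finite := by
  refine Set.Finite.of_injOn (f := fun p => (p.1, .nonterminal p.2.1 :: p.2.2)) (fun p hp => hp) ?_
    (finite_splits s)
  rintro ⟨s₁, n, s₂⟩ _ ⟨s₁', n', s₂'⟩ _ h
  simp_all

theorem finite_paddingRule (g : ContextFreeGrammar (Option T)) :
    {ρ | PaddingRule g ρ}.Finite := by
  have hfin : (⋃ r ∈ g.rules, Set.image2 ContextFreeRule.mk
      {PaddingNT.word r.input, .mixed r.input, .unbounded r.input}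
      ({[.nonterminal (.mixed r.input)]} ∪
        (fun p : List (Symbol (Option T) g.NT) × List (Symbol (Option T) g.NT) =>
          p.2.map unpad) '' {p | p.1 ++ p.2 = r.output} ∪
        (fun p : List (Symbol (Option T) g.NT) × g.NT × List (Symbol (Option T) g.NT) =>
          Symbol.nonterminal (.mixed p.2.1) :: p.2.2.map unpad) ''
          {p | p.1 ++ .nonterminal p.2.1 :: p.2.2 = r.output} ∪
        (fun p : List (Symbol (Option T) g.NT) × g.NT × List (Symbol (Option T) g.NT) =>
          Symbol.nonterminal (.unbounded p.2.1) :: p.2.2.map unpad) ''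
          {p | p.1 ++ .nonterminal p.2.1 :: p.2.2 = r.output})).Finite :=
    g.rules.finite_toSet.biUnion fun r _ => Set.Finite.image2 _ (Set.toFinite _)
      ((((Set.finite_singleton _).union ((finite_splits _).image _)).union
        ((finite_nonterminal_splits _).image _)).union ((finite_nonterminal_splits _).image _))
  refine hfin.subset ?_
  intro ρ hρ
  rw [Set.mem_iUnion₂]
  cases hρ with
  | word hr => exact ⟨_, hr, _, by simp, _, .inl (.inl (.inr ⟨([], _), rfl, rfl⟩)), rfl⟩
  | mixed_end hr hs _ =>
    exact ⟨_, hr, _, by simp, _, .inl (.inl (.inr ⟨(_, _), hs, rfl⟩)), rfl⟩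
  | mixed_step hr hs _ => exact ⟨_, hr, _, by simp, _, .inl (.inr ⟨(_, _, _), hs, rfl⟩), rfl⟩
  | unbounded_step hr hs _ => exact ⟨_, hr, _, by simp, _, .inr ⟨(_, _, _), hs, rfl⟩, rfl⟩
  | unbounded_end hr hs _ =>
    exact ⟨_, hr, _, by simp, _, .inl (.inl (.inr ⟨(_, _), hs, rfl⟩)), rfl⟩
  | unbounded_mixed hr hs _ => exact ⟨_, hr, _, by simp, _, .inl (.inr ⟨(_, _, _), hs, rfl⟩), rfl⟩
  | pump hr _ _ => exact ⟨_, hr, _, by simp, _, .inl (.inl (.inl rfl)), rfl⟩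

/-- A grammar for the words `w` such that `g` generates `padded m w` for infinitely many `m`. -/
noncomputable def dropPadding (g : ContextFreeGrammar (Option T)) : ContextFreeGrammar T where
  NT := PaddingNT g.NT
  initial := .unbounded g.initial
  rules := g.finite_paddingRule.toFinset

theorem mem_rules_dropPadding {ρ : ContextFreeRule T (PaddingNT g.NT)} :
    ρ ∈ g.dropPadding.rules ↔ PaddingRule g ρ :=
  Set.Finite.mem_toFinset _

theorem PaddingRule.yields {ρ : ContextFreeRule T (PaddingNT g.NT)} (h : PaddingRule g ρ)
    {w : List T} (hw : g.dropPadding.Yields ρ.output w) :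
    g.dropPadding.Yields [.nonterminal ρ.input] w :=
  .of_rule (g := g.dropPadding) (mem_rules_dropPadding.2 h) hw

theorem Yields.cons_nonterminal {T : Type*} {g : ContextFreeGrammar T} {n : g.NT}
    {s : List (Symbol T g.NT)} {w₁ w₂ : List T} (h₁ : g.Yields [.nonterminal n] w₁)
    (h₂ : g.Yields s w₂) : g.Yields (.nonterminal n :: s) (w₁ ++ w₂) :=
  h₁.append h₂

/-! ### Soundness of the grammar for unbounded padding -/

/-- The intended languages of the nonterminals of `g.dropPadding`. -/
def paddingLanguage (g : ContextFreeGrammar (Option T)) : PaddingNT g.NT → Language T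
  | .word n => {w | g.Yields [.nonterminal n] (w.map some)}
  | .mixed n => {w | ∃ m, g.Yields [.nonterminal n] (padded m w)}
  | .unbounded n => {w | {m | g.Yields [.nonterminal n] (padded m w)}.Infinite}
  | .dead => 0

theorem yields_of_mem_interp_unpad {s : List (Symbol (Option T) g.NT)} {w : List T}
    (h : w ∈ interp g.paddingLanguage (s.map unpad)) : g.Yields s (w.map some) := by
  induction s generalizing w with
  | nil =>
    obtain rfl : w = [] := h
    exact .nil
  | cons x s ih =>
    match x with
    | .terminal (some t) =>
      obtain ⟨_, rfl, w, hw, rfl⟩ := Language.mem_mul.1 h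
      exact .terminal _ (ih hw)
    | .terminal none =>
      obtain ⟨_, hv, -⟩ := Language.mem_mul.1 h
      exact hv.elim
    | .nonterminal n =>
      obtain ⟨v, hv, w, hw, rfl⟩ := Language.mem_mul.1 h
      rw [List.map_append]
      exact Yields.append (s₁ := [_]) hv (ih hw)

theorem yields_of_split {r : ContextFreeRule (Option T) g.NT} (hr : r ∈ g.rules)
    {s₁ s₂ : List (Symbol (Option T) g.NT)} (hs : s₁ ++ s₂ = r.output) {d m : ℕ} {w : List T}
    (h₁ : g.Yields s₁ (List.replicate d none)) (h₂ : g.Yields s₂ (padded m w)) :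
    g.Yields [.nonterminal r.input] (padded (d + m) w) := by
  rw [← replicate_append_padded]
  exact .of_rule hr (hs ▸ h₁.append h₂)

theorem PaddingRule.mem_paddingLanguage {ρ : ContextFreeRule T (PaddingNT g.NT)}
    (hρ : PaddingRule g ρ) {w : List T} (hw : w ∈ interp g.paddingLanguage ρ.output) :
    w ∈ g.paddingLanguage ρ.input := by
  have hzero : ∀ {s : List (Symbol (Option T) g.NT)} {w : List T}, g.Yields s (w.map some) →
    g.Yields s (padded 0 w) := fun h => by simpa [padded] using h
  cases hρ with
  | word hr => exact .of_rule hr (yields_of_mem_interp_unpad hw)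
  | mixed_end hr hs h => exact ⟨_, yields_of_split hr hs h (hzero (yields_of_mem_interp_unpad hw))⟩
  | mixed_step hr hs h =>
    obtain ⟨w₁, ⟨m, h₁⟩, w₂, h₂, rfl⟩ := Language.mem_mul.1 hw
    refine ⟨_, yields_of_split (m := m) hr hs h ?_⟩
    rw [← padded_append_map_some]
    exact Yields.append (s₁ := [_]) h₁ (yields_of_mem_interp_unpad h₂)
  | @unbounded_step r hr s₁ n s₂ hs d h =>
    obtain ⟨w₁, h₁, w₂, h₂, rfl⟩ := Language.mem_mul.1 hw
    refine (Set.Infinite.image (f := (d + ·)) (by simp) h₁).mono ?_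
    rintro _ ⟨m, hm, rfl⟩
    refine yields_of_split hr hs h ?_
    rw [← padded_append_map_some]
    exact Yields.append (s₁ := [_]) hm (yields_of_mem_interp_unpad h₂)
  | unbounded_end hr hs h =>
    refine h.mono fun d hd => ?_
    exact yields_of_split hr hs hd (hzero (yields_of_mem_interp_unpad hw))
  | unbounded_mixed hr hs h =>
    obtain ⟨w₁, ⟨m, h₁⟩, w₂, h₂, rfl⟩ := Language.mem_mul.1 hw
    refine (Set.Infinite.image (f := (· + m)) (by simp) h).mono ?_
    rintro _ ⟨d, hd, rfl⟩
    refine yields_of_split hr hs hd ?_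
    rw [← padded_append_map_some]
    exact Yields.append (s₁ := [_]) h₁ (yields_of_mem_interp_unpad h₂)
  | @pump r hr k hk h =>
    obtain ⟨m, hm⟩ : w ∈ g.paddingLanguage (.mixed r.input) := by simpa [interp] using hw
    have hiter : ∀ i, g.Yields [.nonterminal r.input] (padded (i * k + m) w) := fun i => by
      induction i with
      | zero => simpa using hm
      | succ i ih =>
        convert h _ _ ih using 2
        ring
    refine Set.infinite_of_injective_forall_mem (f := fun i => i * k + m) (fun i j hij => ?_) hiter
    exact Nat.eq_of_mul_eq_mul_right hk (by simpa using hij)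

/-! ### Completeness of the grammar for unbounded padding -/

theorem Yields.unpad {s : List (Symbol (Option T) g.NT)} {v : List (Option T)}
    (h : g.Yields s v) {w : List T} (hv : v = w.map some) :
    g.dropPadding.Yields (s.map unpad) w := by
  induction h generalizing w with
  | nil =>
    obtain rfl := List.map_eq_nil_iff.1 hv.symm
    exact .nil
  | terminal t _ ih =>
    obtain ⟨t, w, rfl, rfl, hw⟩ := List.map_eq_cons_iff.1 hv.symm
    exact .terminal t (ih hw.symm)
  | nonterminal hr _ _ ihu ih =>
    obtain ⟨w₁, w₂, rfl, h₁, h₂⟩ := List.map_eq_append_iff.1 hv.symm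
    exact Yields.cons_nonterminal (PaddingRule.yields (.word hr) (ihu h₁.symm)) (ih h₂.symm)

theorem yields_mixed_of_total {p : g.NT × List T} {m : ℕ} (h : Total g.EndCost g.Edge p m) :
    g.dropPadding.Yields [.nonterminal (.mixed p.1)] p.2 := by
  induction h with
  | base h =>
    obtain ⟨r, hr, hp, s₁, s₂, hs, h₁, h₂⟩ := h
    rw [← hp]
    exact PaddingRule.yields (.mixed_end hr hs h₁) (h₂.unpad rfl)
  | step h _ ih =>
    obtain ⟨r, hr, hp, s₁, s₂, hs, h₁, w, hw, h₂⟩ := h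
    rw [← hp, hw]
    exact PaddingRule.yields (.mixed_step hr hs h₁) (ih.cons_nonterminal (h₂.unpad rfl))

theorem exists_infinite_of_finite {α β : Type*} {F : Set α} (hF : F.Finite) {Q : α → β → Prop}
    (h : {b | ∃ a ∈ F, Q a b}.Infinite) : ∃ a ∈ F, {b | Q a b}.Infinite := by
  by_contra! hfin
  refine h ((hF.biUnion hfin).subset ?_)
  rintro b ⟨a, ha, hb⟩
  exact Set.mem_iUnion₂.2 ⟨a, ha, hb⟩

/-- Each of the three causes of unboundedness in `WeightedGraph.of_infinite_total` is matched by a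
rule of `g.dropPadding`; a cycle gives a nonterminal that can be pumped, because the prefix of the
word is the same at both ends of the cycle. -/
theorem yields_unbounded_of_infinite {n : g.NT} {w : List T}
    (h : {m | Total g.EndCost g.Edge (n, w) m}.Infinite) :
    g.dropPadding.Yields [.nonterminal (.unbounded n)] w := by
  have hinput : ∀ {p m}, Total g.EndCost g.Edge p m →
      p.1 ∈ ContextFreeRule.input '' {r | r ∈ g.rules} := by
    rintro p m (⟨r, hr, hp, -⟩ | ⟨⟨r, hr, hp, -⟩, -⟩) <;> exact ⟨r, hr, hp⟩
  -- The vertices that can occur: left-hand sides of rules, paired with prefixes of `w`.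
  have hfin : ((ContextFreeRule.input '' {r | r ∈ g.rules}) ×ˢ {v | v ∈ w.inits} :
      Set (g.NT × List T)).Finite :=
    (g.rules.finite_toSet.image _).prod w.inits.finite_toSet
  refine of_infinite_total (P := fun p => g.dropPadding.Yields [.nonterminal (.unbounded p.1)] p.2)
    (x := (n, w)) hfin ?_ ?_ ?_ ?_ ?_ ?_ h
  · rintro p ⟨-, hp⟩ j q m ⟨-, -, -, -, -, -, -, v, hv, -⟩ hq
    refine ⟨hinput hq, (List.mem_inits _ _).2 (.trans ?_ ((List.mem_inits _ _).1 hp))⟩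
    exact ⟨v, hv.symm⟩
  · rintro p - hp
    obtain ⟨r, hr, hp⟩ := exists_infinite_of_finite g.rules.finite_toSet hp
    obtain ⟨⟨s₁, s₂⟩, hs, hp⟩ := exists_infinite_of_finite (finite_splits r.output)
      (Q := fun q d => r.input = p.1 ∧ g.Yields q.1 (List.replicate d none) ∧
        g.Yields q.2 (p.2.map some))
      (hp.mono (by rintro d ⟨hin, s₁, s₂, hs, h₁, h₂⟩; exact ⟨(s₁, s₂), hs, hin, h₁, h₂⟩))
    obtain ⟨-, hin, -, h₂⟩ := hp.nonempty
    rw [← hin]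
    exact PaddingRule.yields (.unbounded_end hr hs (hp.mono fun d hd => hd.2.1)) (h₂.unpad rfl)
  · rintro p - q - m hpq hq
    obtain ⟨r, hr, hpq⟩ := exists_infinite_of_finite g.rules.finite_toSet hpq
    obtain ⟨⟨s₁, n, s₂⟩, hs, hpq⟩ := exists_infinite_of_finite (finite_nonterminal_splits r.output)
      (Q := fun a d => r.input = p.1 ∧ a.2.1 = q.1 ∧ g.Yields a.1 (List.replicate d none) ∧
        ∃ v, p.2 = q.2 ++ v ∧ g.Yields a.2.2 (v.map some))
      (hpq.mono (by
        rintro d ⟨hin, s₁, s₂, hs, h₁, h₂⟩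
        exact ⟨(s₁, q.1, s₂), hs, hin, rfl, h₁, h₂⟩))
    obtain ⟨-, hin, rfl, -, v, hv, h₂⟩ := hpq.nonempty
    rw [← hin, hv]
    exact PaddingRule.yields (.unbounded_mixed hr hs (hpq.mono fun d hd => hd.2.2.1))
      ((yields_mixed_of_total hq).cons_nonterminal (h₂.unpad rfl))
  · rintro p - j q ⟨r, hr, hp, s₁, s₂, hs, h₁, v, hv, h₂⟩ hq
    rw [← hp, hv]
    exact PaddingRule.yields (.unbounded_step hr hs h₁) (hq.cons_nonterminal (h₂.unpad rfl))
  · rintro p ⟨⟨r, hr, hp⟩, -⟩ k m hk hreach htot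
    obtain ⟨v, hv, hpump⟩ := yields_of_reach hreach
    obtain rfl : v = [] := by simpa using hv
    have hmixed := yields_mixed_of_total htot
    rw [← hp] at hmixed hpump ⊢
    exact PaddingRule.yields (.pump hr hk fun m v h => by simpa using hpump m v h) hmixed
  · obtain ⟨m, hm⟩ := h.nonempty
    exact ⟨hinput hm, (List.mem_inits _ _).2 (List.prefix_refl _)⟩

theorem mem_language_dropPadding {w : List T} :
    w ∈ g.dropPadding.language ↔ {m | padded m w ∈ g.language}.Infinite := by
  simp only [mem_language_iff_yields]
  constructor
  · intro h
    exact h.mem_of_closed (I := g.paddingLanguage)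
      fun ρ hρ w hw => (mem_rules_dropPadding.1 hρ).mem_paddingLanguage hw
  · intro h
    exact yields_unbounded_of_infinite (h.mono fun m hm => total_iff_yields.2 hm)

end ContextFreeGrammar

open ContextFreeGrammar in
/-- If `L` is a context-free language, then so is the set of words that belong to `L` when preceded
by infinitely many lengths of padding. -/
theorem Language.IsContextFree.dropPadding {T : Type*} {L : Language (Option T)}
    (hL : L.IsContextFree) :
    Language.IsContextFree ({w | {m | padded m w ∈ L}.Infinite} : Language T) := by
  obtain ⟨g, rfl⟩ := hL
  exact ⟨g.dropPadding, Set.ext fun w => mem_language_dropPadding⟩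

/-! ### Blocks, shift spaces and compactness -/

namespace SymDyn

variable {A B : Type*}

theorem block_zero (x : ℤ → A) (i : ℤ) : block x i 0 = [] := rfl

theorem block_succ (x : ℤ → A) (i : ℤ) (n : ℕ) :
    block x i (n + 1) = x i :: block x (i + 1) n := by
  simp [block, List.ofFn_succ, add_assoc, add_comm (1 : ℤ)]

@[simp]
theorem length_block (x : ℤ → A) (i : ℤ) (n : ℕ) : (block x i n).length = n := by
  simp [block]

theorem drop_block (x : ℤ → A) (i : ℤ) (m n : ℕ) :
    (block x i (m + n)).drop m = block x (i + m) n := by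
  induction m generalizing i with
  | zero => simp
  | succ m ih =>
    rw [add_right_comm, block_succ, List.drop_succ_cons, ih]
    push_cast
    congr 1
    ring

theorem block_shift (x : ℤ → A) (c i : ℤ) (n : ℕ) :
    block (fun k => x (k + c)) i n = block x (i + c) n := by
  simp [block, add_right_comm]

theorem block_eq_iff {x : ℤ → A} {i : ℤ} {w : List A} :
    block x i w.length = w ↔ ∀ k : Fin w.length, x (i + (k : ℕ)) = w[k] := by
  have h : w = List.ofFn fun k : Fin w.length => w[k] := List.ofFn_getElem.symm
  conv_lhs => rhs; rw [h]
  exact List.ofFn_injective.eq_iff.trans funext_iff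

theorem occurs_block (x : ℤ → A) (i : ℤ) (n : ℕ) : Occurs (block x i n) x :=
  ⟨i, by rw [length_block]⟩

theorem IsShiftSpace.shift {X : Set (ℤ → A)} (hX : IsShiftSpace X) (c : ℤ) {x : ℤ → A}
    (hx : x ∈ X) : (fun k => x (k + c)) ∈ X := by
  obtain ⟨forb, rfl⟩ := hX
  rintro w hw ⟨i, hi⟩
  exact hx w hw ⟨i + c, by rw [← block_shift, hi]⟩

theorem IsShiftSpace.isClosed [TopologicalSpace A] [DiscreteTopology A] {X : Set (ℤ → A)}
    (hX : IsShiftSpace X) : IsClosed X := by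
  obtain ⟨forb, rfl⟩ := hX
  have h : avoiding forb = ⋂ w ∈ forb, ⋂ i : ℤ,
      {x | ∀ k : Fin w.length, x (i + (k : ℕ)) = w[k]}ᶜ := by
    ext x
    simp [avoiding, Occurs, block_eq_iff]
  rw [h]
  refine isClosed_biInter fun w _ => isClosed_iInter fun i => isOpen_compl_iff.1 ?_
  have h : {x : ℤ → A | ∀ k : Fin w.length, x (i + (k : ℕ)) = w[k]} =
      ⋂ k : Fin w.length, {x | x (i + (k : ℕ)) = w[k]} := by
    ext x
    simp
  rw [compl_compl, h]
  refine isOpen_iInter_of_finite fun k => ?_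
  have hk : Continuous fun x : ℤ → A => x (i + (k : ℕ)) := continuous_apply _
  exact (isOpen_discrete {w[k]}).preimage hk

/-! ### The transduction from a functional shift to the shift it generates -/

/-- The output letter `o` at a time when the current state is `a`: either the state itself or the
padding letter. -/
def PadOrSelf (o : Option A) (a : A) : Prop := o = none ∨ o = some a

theorem forall₂_padOrSelf_padded {m : ℕ} {w l : List A} :
    List.Forall₂ PadOrSelf (ContextFreeGrammar.padded m w) l ↔
      l.length = m + w.length ∧ l.drop m = w := by
  induction m generalizing l with
  | zero =>
    have h : List.Forall₂ PadOrSelf (w.map some) l ↔ l = w := by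
      rw [List.forall₂_map_left_iff]
      have : (fun a c : A => PadOrSelf (some a) c) = Eq := by
        ext a c
        simp [PadOrSelf]
      rw [this, List.forall₂_eq_eq_eq, eq_comm]
    simp only [ContextFreeGrammar.padded, List.replicate_zero, List.nil_append, h, List.drop_zero,
      zero_add]
    exact ⟨fun h => ⟨by rw [h], h⟩, fun h => h.2⟩
  | succ m ih =>
    have hm : ContextFreeGrammar.padded (m + 1) w = none :: ContextFreeGrammar.padded m w := by
      simp [ContextFreeGrammar.padded, List.replicate_succ]
    rw [hm]
    cases l with
    | nil =>
      simp only [List.forall₂_nil_right_iff, reduceCtorEq, List.length_nil, false_iff, not_and]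
      omega
    | cons a l => simp [PadOrSelf, ih, add_right_comm]

/-- The transition relation of the transducer: its state is an element `a` of `A`, encoded by `e`;
reading a map `f`, it moves to `f a` and writes either `a` or the padding letter. -/
def orbitStep {F : Set (A → A)} {Q : Type} (e : A ≃ Q) (q : Q) (f : F) (o : Option A) (q' : Q) :
    Prop :=
  PadOrSelf o (e.symm q) ∧ q' = e ((f : A → A) (e.symm q))

/-- Along an orbit `x` of `f`, the runs of the transducer on the blocks of `f` write the blocks of
`x` with some letters replaced by padding. -/
theorem run_orbitStep_iff {F : Set (A → A)} {Q : Type} (e : A ≃ Q) {f : ℤ → F} {x : ℤ → A} {i : ℤ}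
    {n : ℕ} (hx : ∀ k, i ≤ k → x (k + 1) = (f k : A → A) (x k)) {o : List (Option A)} {q' : Q} :
    ContextFreeGrammar.Run (orbitStep e) (e (x i)) (block f i n) o q' ↔
      List.Forall₂ PadOrSelf o (block x i n) ∧ q' = e (x (i + n)) := by
  induction n generalizing i o with
  | zero =>
    simp only [block_zero, List.forall₂_nil_right_iff, Nat.cast_zero, add_zero]
    constructor
    · intro h
      cases h
      exact ⟨rfl, rfl⟩
    · rintro ⟨rfl, rfl⟩
      exact .nil _
  | succ n ih =>
    have ih' := fun o => ih (o := o) (i := i + 1) fun k hk => hx k (by omega)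
    have hi : i + 1 + (n : ℤ) = i + ((n + 1 : ℕ) : ℤ) := by
      push_cast
      ring
    rw [block_succ, block_succ]
    constructor
    · intro h
      cases h with
      | cons ht h =>
        obtain ⟨ho, rfl⟩ := ht
        rw [e.symm_apply_apply] at ho h
        rw [← hx i le_rfl, ih', hi] at h
        exact ⟨.cons ho h.1, h.2⟩
    · rintro ⟨h, rfl⟩
      cases h with
      | cons ho h =>
        refine .cons (q' := e (x (i + 1))) ⟨by simpa using ho, by simp [hx i le_rfl]⟩ ?_
        exact (ih' _).2 ⟨h, by rw [hi]⟩

/-- A half-infinite sequence of maps has an orbit starting at any given state at any given time.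
The values before that time are irrelevant. -/
theorem exists_orbit_from (f : ℤ → A → A) (i : ℤ) (a : A) :
    ∃ x : ℤ → A, x i = a ∧ ∀ k, i ≤ k → x (k + 1) = f k (x k) := by
  let s : ℕ → A := fun n => Nat.rec a (fun j b => f (i + j) b) n
  refine ⟨fun k => s (k - i).toNat, by simp [s], fun k hk => ?_⟩
  obtain ⟨n, rfl⟩ := Int.le.dest hk
  have h₁ : (i + n + 1 - i).toNat = n + 1 := by omega
  have h₂ : (i + n - i).toNat = n := by omega
  simp only [h₁, h₂]
  rfl

/-- By compactness, orbits with arbitrarily long but finite past that pass through the word `w`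
yield a point of the generated shift in which `w` occurs. -/
theorem mem_blockLanguage_of_long_past [Finite A] {F : Set (A → A)} {𝓕 : Set (ℤ → F)}
    (h𝓕 : IsShiftSpace 𝓕) {w : List A}
    (h : ∀ m : ℕ, ∃ f ∈ 𝓕, ∃ x : ℤ → A, (∀ k, -(m : ℤ) ≤ k → x (k + 1) = (f k : A → A) (x k)) ∧
      block x 0 w.length = w) :
    w ∈ blockLanguage (generatedShift 𝓕) := by
  let : TopologicalSpace A := ⊥
  have : DiscreteTopology A := ⟨rfl⟩
  let C : ℕ → Set ((ℤ → F) × (ℤ → A)) := fun m => {p | p.1 ∈ 𝓕 ∧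
    (∀ k, -(m : ℤ) ≤ k → p.2 (k + 1) = (p.1 k : A → A) (p.2 k)) ∧
      ∀ k : Fin w.length, p.2 (0 + (k : ℕ)) = w[k]}
  have hC : ∀ m, IsClosed (C m) := fun m => by
    have hev : Continuous fun q : F × A => (q.1 : A → A) q.2 := continuous_of_discreteTopology
    have hstep : ∀ k : ℤ, Continuous fun p : (ℤ → F) × (ℤ → A) => (p.1 k : A → A) (p.2 k) :=
      fun k => hev.comp (f := fun p : (ℤ → F) × (ℤ → A) => (p.1 k, p.2 k)) (by fun_prop)
    have hCm : C m = Prod.fst ⁻¹' 𝓕 ∩ ((⋂ k : ℤ, ⋂ _ : -(m : ℤ) ≤ k,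
        {p : (ℤ → F) × (ℤ → A) | p.2 (k + 1) = (p.1 k : A → A) (p.2 k)}) ∩
          ⋂ k : Fin w.length, {p : (ℤ → F) × (ℤ → A) | p.2 (0 + (k : ℕ)) = w[k]}) := by
      ext p
      simp [C]
    rw [hCm]
    exact (h𝓕.isClosed.preimage continuous_fst).inter
      ((isClosed_iInter fun k => isClosed_iInter fun _ => isClosed_eq (by fun_prop) (hstep k)).inter
        (isClosed_iInter fun k => isClosed_eq (by fun_prop) continuous_const))
  obtain ⟨⟨f, x⟩, hfx⟩ := IsCompact.nonempty_iInter_of_sequence_nonempty_isCompact_isClosed C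
    (fun m p hp => ⟨hp.1, fun k hk => hp.2.1 k (by push_cast; omega), hp.2.2⟩)
    (fun m => by
      obtain ⟨f, hf, x, hx, hw⟩ := h m
      exact ⟨(f, x), hf, hx, block_eq_iff.1 hw⟩)
    (hC 0).isCompact hC
  rw [Set.mem_iInter] at hfx
  refine ⟨x, ⟨f, (hfx 0).1, fun k => (hfx k.natAbs).2.1 k (by omega)⟩, 0, ?_⟩
  exact block_eq_iff.2 (hfx 0).2.2

/-- A word occurs in the generated shift if and only if it is, preceded by infinitely many lengths
of padding, an output of the transducer on the language of the functional shift. -/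
theorem mem_blockLanguage_generatedShift_iff [Finite A] {F : Set (A → A)} {𝓕 : Set (ℤ → F)}
    (h𝓕 : IsShiftSpace 𝓕) {Q : Type} (e : A ≃ Q) {w : List A} :
    w ∈ blockLanguage (generatedShift 𝓕) ↔
      {m | ∃ v ∈ blockLanguage 𝓕, ∃ q q', ContextFreeGrammar.Run (orbitStep e) q v
        (ContextFreeGrammar.padded m w) q'}.Infinite := by
  constructor
  · rintro ⟨x, ⟨f, hf, hx⟩, i, hi⟩
    refine Set.infinite_univ.mono fun m _ => ?_
    refine ⟨block f (i - m) (m + w.length), ⟨f, hf, occurs_block _ _ _⟩, e (x (i - m)), _,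
      (run_orbitStep_iff e fun k _ => hx k).2 ⟨forall₂_padOrSelf_padded.2 ⟨by simp, ?_⟩, rfl⟩⟩
    rw [drop_block, sub_add_cancel, hi]
  · intro h
    refine mem_blockLanguage_of_long_past h𝓕 fun m => ?_
    obtain ⟨m', ⟨v, ⟨f, hf, i, hv⟩, q, q', hrun⟩, hm⟩ := h.exists_gt m
    obtain ⟨x, hxi, hx⟩ := exists_orbit_from (fun k => (f k : A → A)) i (e.symm q)
    obtain rfl : q = e (x i) := by simp [hxi]
    rw [← hv, run_orbitStep_iff e hx, forall₂_padOrSelf_padded, length_block] at hrun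
    obtain ⟨⟨hlen, hw⟩, -⟩ := hrun
    -- Shift time so that `w` starts at `0`.
    refine ⟨_, h𝓕.shift (i + m') hf, fun k => x (k + (i + m')), fun k hk => ?_, ?_⟩
    · simpa [add_right_comm] using hx (k + (i + m')) (by omega)
    · rw [hlen, drop_block] at hw
      rw [block_shift, zero_add, hw]

end SymDyn

/-- A functional shift is a shift space `𝓕` over the alphabet `F`, where `F` is a set of self-maps
of the finite nonempty alphabet `A`. -/
theorem mainTheorem3 {A : Type*} [Finite A] [Nonempty A] (F : Set (A → A))
    (𝓕 : Set (ℤ → F)) (h𝓕 : SymDyn.IsShiftSpace 𝓕)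
    (hcf : (SymDyn.blockLanguage 𝓕).IsContextFree) :
    (SymDyn.blockLanguage (SymDyn.generatedShift 𝓕)).IsContextFree := by
  have h := (hcf.transduce (SymDyn.orbitStep (Finite.equivFin A)) Set.univ Set.univ).dropPadding
  simp only [Set.mem_univ, true_and] at h
  have hL : SymDyn.blockLanguage (SymDyn.generatedShift 𝓕) =
      {w | {m | ContextFreeGrammar.padded m w ∈ ({o | ∃ v ∈ SymDyn.blockLanguage 𝓕, ∃ q q',
        ContextFreeGrammar.Run (SymDyn.orbitStep (Finite.equivFin A)) q v o q'} : Language (Option A))}.Infinite} :=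
    Set.ext fun w => SymDyn.mem_blockLanguage_generatedShift_iff h𝓕 (Finite.equivFin A)
  rw [hL]
  exact h
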